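/- \textbf{Definitions.} Let $L$ be a modular lattice of finite length, with least element $0$, greatest element $1$ and height function $h$ ($h(u)$ is the greatest length of a chain in $[0,u]$). An element $z\in L$ is a \emph{cycle} if the interval $[0,z]$ is a chain and a \emph{dual cycle} if $[z,1]$ is a chain. $L$ is \emph{semi-primary} if every element is a join of cycles and a meet of dual cycles. Elements $u_1,\dots,u_k$ are \emph{independent} if $\bigl(\bigvee_{j\neq i}u_j\bigr)\wedge u_i=0$ for every $i$. In a semi-primary lattice every element $u$ is the join of independent nonzero cycles $z_1,\dots,z_k$, and their heights are uniquely determined up to order; the partition formed by $h(z_1),\dots,h(z_k)$ in decreasing order is the \emph{type} of $u$, and the type of $L$ is the type of $1$. Partitions differing only by zeros are identified, $\mu\le\lambda$ means $\mu_i\le\lambda_i$ for all $i$, $(s^n)$ is the partition with $n$ parts $s$, and for $\mu\le\lambda=(s^n)$ one puts $\lambda-\mu=(s-\mu_n,\dots,s-\mu_1)$. A finite semi-primary lattice $L$ is \emph{down-enumerable} if for all $u,v\in L$ of the same type and every partition $\mu$ there are as many elements of type $\mu$ below (i.e. $\le$) $u$ as below $v$; then $\alpha(\varphi,\mu)$ denotes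 the number of elements of type $\mu$ below an element of type $\varphi$. It is \emph{up-enumerable} if the same holds with ``above'' ($\ge$) in place of ``below''; then $\beta(\varphi,\mu)$ denotes the number of elements of type $\mu$ above an element of type $\varphi$. It is \emph{enumerable} if it is both down-enumerable and up-enumerable. \textbf{Theorem.} Let $L$ be a down-enumerable lattice that is self-dual (isomorphic to its order dual) and has type $\lambda=(s^n)$ for some positive integers $s,n$. Assume that for every cycle $z\in L$ there is a cycle $z'\in L$ with $z\le z'$ and $h(z')=s$. Then $L$ is enumerable, and for all partitions $\mu,\varphi\le\lambda$ there are elements of $L$ of types $\mu$ and $\lambda-\mu$ (so that both sides of the following equation are defined) and $$\beta(\mu,\varphi)=\alpha(\lambda-\mu,\lambda-\varphi).$$ -/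

import Mathlib

/-!
# Semi-primary lattices, types of elements, and enumerable lattices

Partitions of nonnegative integers (up to trailing zeros) are Mathlib's `YoungDiagram`s: the
`i`-th part of `μ` (counted from `0`) is `μ.rowLen i`, the number of nonzero parts is `μ.colLen 0`,
and `μ ≤ ν` is inclusion of Ferrers diagrams, that is, `μ.rowLen i ≤ ν.rowLen i` for all `i`.
The height of an element of a lattice is `Order.height`.
-/

/-- The partition `(s^n) = (s, …, s)` with `n` entries `s`. -/
def rectPartition (s n : ℕ) : YoungDiagram :=
  YoungDiagram.ofRowLens (List.replicate n s)
    (List.Pairwise.sortedGE (List.pairwise_replicate.mpr (Or.inr le_rfl)))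

/-- The sequence `(s - μ_n, …, s - μ_1)` is decreasing. -/
theorem sortedGE_rectSub (s n : ℕ) (μ : YoungDiagram) :
    (List.ofFn fun i : Fin n => s - μ.rowLen (Fin.rev i)).SortedGE := by
  rw [List.sortedGE_ofFn_iff]
  intro i j hij
  have h : ((Fin.rev j : Fin n) : ℕ) ≤ (Fin.rev i : Fin n) := Fin.rev_le_rev.mpr hij
  exact Nat.sub_le_sub_left (μ.rowLen_anti _ _ h) s

/-- For `μ ≤ (s^n)`, the partition `(s^n) - μ = (s - μ_n, …, s - μ_1)`. -/
def rectSub (s n : ℕ) (μ : YoungDiagram) : YoungDiagram :=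
  YoungDiagram.ofRowLens (List.ofFn fun i : Fin n => s - μ.rowLen (Fin.rev i))
    (sortedGE_rectSub s n μ)

/-- `z` is a cycle: the interval `[0, z]` is a chain. -/
def IsCycle {L : Type*} [Lattice L] [BoundedOrder L] (z : L) : Prop :=
  IsChain (· ≤ ·) (Set.Icc ⊥ z)

/-- `z` is a dual cycle: the interval `[z, 1]` is a chain. -/
def IsDualCycle {L : Type*} [Lattice L] [BoundedOrder L] (z : L) : Prop :=
  IsChain (· ≤ ·) (Set.Icc z ⊤)

/-- A modular lattice of finite length is semi-primary if every element is a join of cycles and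
a meet of dual cycles. -/
structure IsSemiPrimary (L : Type*) [Lattice L] [BoundedOrder L] : Prop where
  modular : IsModularLattice L
  finiteLength : FiniteDimensionalOrder L
  join_cycles : ∀ u : L, ∃ S : Finset L, (∀ z ∈ S, IsCycle z) ∧ S.sup id = u
  meet_dualCycles : ∀ u : L, ∃ S : Finset L, (∀ z ∈ S, IsDualCycle z) ∧ S.inf id = u

/-- The elements `z_1, …, z_k` are independent: the join of all `z_j` with `j ≠ i` meets `z_i`
in `0`, for every `i`. -/
def IsIndependent {L : Type*} [Lattice L] [BoundedOrder L] {k : ℕ} (z : Fin k → L) : Prop :=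
  ∀ i, (Finset.univ.erase i).sup z ⊓ z i = ⊥

/-- `u` has type `μ`: `u` is the join of independent nonzero cycles whose heights, listed in
decreasing order, are the nonzero parts of `μ`. (In a semi-primary lattice every element has
exactly one type.) -/
def HasType {L : Type*} [Lattice L] [BoundedOrder L] (u : L) (μ : YoungDiagram) : Prop :=
  ∃ z : Fin (μ.colLen 0) → L,
    (∀ i, IsCycle (z i) ∧ z i ≠ ⊥) ∧ IsIndependent z ∧ Finset.univ.sup z = u ∧
      ∀ i, Order.height (z i) = μ.rowLen i

/-- The number of elements of type `μ` below `u`. -/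
noncomputable def downCount {L : Type*} [Lattice L] [BoundedOrder L] (u : L)
    (μ : YoungDiagram) : ℕ :=
  {w : L | HasType w μ ∧ w ≤ u}.ncard

/-- The number of elements of type `μ` above `u`. -/
noncomputable def upCount {L : Type*} [Lattice L] [BoundedOrder L] (u : L)
    (μ : YoungDiagram) : ℕ :=
  {w : L | HasType w μ ∧ u ≤ w}.ncard

/-- A finite semi-primary lattice is down-enumerable if the number of elements of a given type
below `u` depends only on the type of `u`. -/
structure IsDownEnumerable (L : Type*) [Lattice L] [BoundedOrder L] : Prop where
  finite : Finite L
  semiPrimary : IsSemiPrimary L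
  downCount_eq : ∀ (u v : L) (φ : YoungDiagram), HasType u φ → HasType v φ →
    ∀ μ : YoungDiagram, downCount u μ = downCount v μ

/-- A finite semi-primary lattice is up-enumerable if the number of elements of a given type
above `u` depends only on the type of `u`. -/
structure IsUpEnumerable (L : Type*) [Lattice L] [BoundedOrder L] : Prop where
  finite : Finite L
  semiPrimary : IsSemiPrimary L
  upCount_eq : ∀ (u v : L) (φ : YoungDiagram), HasType u φ → HasType v φ →
    ∀ μ : YoungDiagram, upCount u μ = upCount v μ

/-- Enumerable: down-enumerable and up-enumerable. -/
structure IsEnumerable (L : Type*) [Lattice L] [BoundedOrder L] : Prop where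
  down : IsDownEnumerable L
  up : IsUpEnumerable L

open Classical in
/-- `α(φ, μ)`: the number of elements of type `μ` below an element of type `φ` (and `0` if there is
no element of type `φ`). It does not depend on the chosen element if `L` is down-enumerable. -/
noncomputable def enumAlpha (L : Type*) [Lattice L] [BoundedOrder L] (φ μ : YoungDiagram) : ℕ :=
  if h : ∃ u : L, HasType u φ then downCount h.choose μ else 0

open Classical in
/-- `β(φ, μ)`: the number of elements of type `μ` above an element of type `φ` (and `0` if there is
no element of type `φ`). It does not depend on the chosen element if `L` is up-enumerable. -/
noncomputable def enumBeta (L : Type*) [Lattice L] [BoundedOrder L] (φ μ : YoungDiagram) : ℕ :=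
  if h : ∃ u : L, HasType u φ then upCount h.choose μ else 0

/-! A duality `σ` of `L` sends elements of type `μ` to elements of type `λ - μ` (`HasType.dual`).
Since `σ` exchanges "above" and "below", counts above `u` become counts below `σ u`, and
down-enumerability yields both claims.

The type statement rests on frames: `n` independent cycles of height `s` with join `1`. Write `u` as
a join of independent nonzero cycles. Each lies below a cycle of height `s`; the larger cycles are
still independent, because a cycle is disjoint from an element as soon as a nonzero part of it is.
They extend to a frame `y` (`IsFrame.extend`): a join of fewer than `n` cycles misses some atom
(`IsFrame.exists_atom_not_le`), and a cycle of height `s` above that atom can be added. Thus `u` is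
the join of elements `w i ≤ y i` of heights `μ_i`.

Let `D i` be the join of the `y j` with `j ≠ i`. By modularity `[D i, 1]` is a chain of length `s`,
so the `σ (D i)` form a frame too. Moreover `u` is the meet of the `w i ⊔ D i`, hence `σ u` is the
join of the independent cycles `σ (w i ⊔ D i)`, of heights `s - μ_i`. -/

/-! ### Height as a modular rank function. -/

section Rank

variable {L : Type*} [Lattice L]

/-- The height of an element of a finite lattice, as a natural number. -/
noncomputable def latticeRank (u : L) : ℕ := (Order.height u).toNat

theorem latticeRank_bot [OrderBot L] : latticeRank (⊥ : L) = 0 := by simp [latticeRank]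

variable [Finite L]

theorem coe_latticeRank (u : L) : (latticeRank u : ℕ∞) = Order.height u := by
  refine ENat.natCast_toNat fun h => ?_
  cases nonempty_fintype L
  obtain ⟨p, -, hp⟩ := Order.height_eq_top_iff.mp h (Fintype.card L)
  exact absurd (hp ▸ p.length_lt_card) (lt_irrefl _)

theorem latticeRank_lt {a b : L} (h : a < b) : latticeRank a < latticeRank b := by
  have := Order.height_add_one_le h
  rw [← coe_latticeRank, ← coe_latticeRank] at this
  exact_mod_cast this

theorem latticeRank_mono {a b : L} (h : a ≤ b) : latticeRank a ≤ latticeRank b := by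
  have := Order.height_mono h
  rw [← coe_latticeRank, ← coe_latticeRank] at this
  exact_mod_cast this

theorem eq_of_le_of_latticeRank_le {a b : L} (h : a ≤ b) (hr : latticeRank b ≤ latticeRank a) :
    a = b := by
  by_contra hne
  exact absurd (latticeRank_lt (lt_of_le_of_ne h hne)) (not_lt.mpr hr)

theorem exists_le_latticeRank_eq {z : L} {m : ℕ} (h : m ≤ latticeRank z) :
    ∃ w ≤ z, latticeRank w = m := by
  rcases h.eq_or_lt with rfl | h
  · exact ⟨z, le_rfl, rfl⟩
  have h' : (m : ℕ∞) < Order.height z := by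
    rw [← coe_latticeRank]; exact_mod_cast h
  have hfin : Order.height z < ⊤ := by
    rw [← coe_latticeRank]; exact WithTop.coe_lt_top _
  obtain ⟨w, hw, hm⟩ := (Order.coe_lt_height_iff hfin).mp h'
  rw [← coe_latticeRank] at hm
  exact ⟨w, hw.le, by exact_mod_cast hm⟩

variable [BoundedOrder L]

theorem latticeRank_eq_zero {a : L} : latticeRank a = 0 ↔ a = ⊥ := by
  refine ⟨fun h => ?_, fun h => h ▸ latticeRank_bot⟩
  exact (eq_of_le_of_latticeRank_le bot_le (by omega)).symm

theorem exists_covBy_latticeRank {b : L} (h : b ≠ ⊥) :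
    ∃ c, c ⋖ b ∧ latticeRank b = latticeRank c + 1 := by
  obtain ⟨m, hm⟩ := Nat.exists_eq_succ_of_ne_zero (mt latticeRank_eq_zero.mp h)
  have hb : Order.height b = m + 1 := by rw [← coe_latticeRank, hm]; simp
  obtain ⟨-, ⟨c, hc, hcm⟩, -⟩ := Order.height_eq_coe_add_one_iff.mp hb
  have hcr : latticeRank c = m := by rw [← coe_latticeRank] at hcm; exact_mod_cast hcm
  refine ⟨c, ⟨hc, fun w h1 h2 => ?_⟩, by omega⟩
  have := latticeRank_lt h1
  have := latticeRank_lt h2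
  omega

variable [IsModularLattice L]

/-- Some lower cover `c` of `b` realises the height. By modularity `a ⊓ c` is covered by both `a`
and `c`, so induction at `c` bounds the height of `a` from below. -/
theorem latticeRank_covBy {a b : L} (h : a ⋖ b) : latticeRank b = latticeRank a + 1 := by
  induction b using WellFoundedLT.induction generalizing a with
  | ind b ih =>
    obtain ⟨c, hc, hr⟩ := exists_covBy_latticeRank (bot_le.trans_lt h.lt).ne'
    rcases eq_or_ne a c with rfl | hne
    · exact hr
    have hsup : a ⊔ c = b := h.wcovBy.sup_eq hc.wcovBy hne
    have h1 : a ⊓ c ⋖ c := by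
      apply CovBy.inf_of_sup_left
      rwa [hsup]
    have h2 : a ⊓ c ⋖ a := by
      apply CovBy.inf_of_sup_right
      rwa [hsup]
    have e1 := ih c hc.lt h1
    have e2 := latticeRank_lt h2.lt
    have e3 := latticeRank_lt h.lt
    omega

/-- Descend from `a` to `a ⊓ b` one cover at a time; modularity carries each cover to a cover
between `a ⊔ b` and `b`. -/
theorem latticeRank_sup_add_inf (a b : L) :
    latticeRank (a ⊔ b) + latticeRank (a ⊓ b) = latticeRank a + latticeRank b := by
  induction a using WellFoundedLT.induction with
  | ind a ih =>
    by_cases hab : a ≤ b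
    · rw [sup_of_le_right hab, inf_of_le_left hab, add_comm]
    have hlt : a ⊓ b < a := inf_lt_left.mpr hab
    obtain ⟨c, hc1, hc2⟩ := exists_le_covBy_of_lt hlt
    have hcb : c ⊓ b = a ⊓ b :=
      le_antisymm (inf_le_inf_right _ hc2.le) (le_inf hc1 inf_le_right)
    have h1 : a ⊓ (c ⊔ b) = c := by
      rw [inf_comm, sup_inf_assoc_of_le b hc2.le, inf_comm b a, sup_of_le_left hc1]
    have h2 : c ⊔ b ⋖ a ⊔ (c ⊔ b) := by
      apply CovBy.sup_of_inf_left
      rwa [h1]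
    rw [← sup_assoc, sup_of_le_left hc2.le] at h2
    have e1 := ih c hc2.lt
    rw [hcb] at e1
    have e2 := latticeRank_covBy h2
    have e3 := latticeRank_covBy hc2
    omega

theorem latticeRank_sup_of_disjoint {a b : L} (h : Disjoint a b) :
    latticeRank (a ⊔ b) = latticeRank a + latticeRank b := by
  have := latticeRank_sup_add_inf a b
  rwa [h.eq_bot, latticeRank_bot, add_zero] at this

theorem latticeRank_finset_sup {ι : Type*} {t : Finset ι} {f : ι → L} (h : t.SupIndep f) :
    latticeRank (t.sup f) = ∑ i ∈ t, latticeRank (f i) := by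
  classical
  induction t using Finset.induction_on with
  | empty => simp [latticeRank_bot]
  | insert a t ha ih =>
    rw [Finset.sup_insert, Finset.sum_insert ha, latticeRank_sup_of_disjoint,
      ih (h.subset (Finset.subset_insert _ _))]
    exact h (Finset.subset_insert _ _) (Finset.mem_insert_self _ _) ha

/-- An order-reversing bijection turns rank into corank. -/
theorem latticeRank_add_latticeRank_dual (σ : L ≃o Lᵒᵈ) (x : L) :
    latticeRank x + latticeRank (OrderDual.ofDual (σ x)) = latticeRank (⊤ : L) := by
  induction x using WellFoundedLT.induction with
  | ind x ih =>
    rcases eq_or_ne x ⊥ with rfl | hx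
    · rw [latticeRank_bot, zero_add, map_bot]; rfl
    obtain ⟨c, hc, hr⟩ := exists_covBy_latticeRank hx
    have h1 : OrderDual.ofDual (σ x) ⋖ OrderDual.ofDual (σ c) :=
      ((apply_covBy_apply_iff σ).mpr hc).ofDual
    have e1 := latticeRank_covBy h1
    have e2 := ih c hc.lt
    omega

end Rank

/-! ### Cycles, independence and complemented intervals. -/

section Cycles

variable {L : Type*} [Lattice L] [BoundedOrder L]

theorem IsCycle.mono {z w : L} (hz : IsCycle z) (h : w ≤ z) : IsCycle w :=
  IsChain.mono (Set.Icc_subset_Icc le_rfl h) hz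

theorem IsCycle.le_total {z a b : L} (hz : IsCycle z) (ha : a ≤ z) (hb : b ≤ z) :
    a ≤ b ∨ b ≤ a :=
  IsChain.total hz ⟨bot_le, ha⟩ ⟨bot_le, hb⟩

/-- In the chain `[0, z]` the elements `w` and `z ⊓ b` are comparable, and `w ≤ z ⊓ b` would force
`w = ⊥`. -/
theorem IsCycle.disjoint_of_disjoint {z w b : L} (hz : IsCycle z) (hw : w ≤ z) (h0 : w ≠ ⊥)
    (h : Disjoint w b) : Disjoint z b := by
  rcases hz.le_total hw (inf_le_left : z ⊓ b ≤ z) with h1 | h1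
  · exact absurd (h le_rfl (h1.trans inf_le_right)) (by simpa using h0)
  · exact fun x hx hb => h ((le_inf hx hb).trans h1) hb

variable [IsModularLattice L]

/-- Modularity gives `x = b ⊔ z ⊓ x` on this interval, so its order is inherited from the chain `[0,
z]`. -/
theorem IsCycle.isChain_Icc_sup {z : L} (hz : IsCycle z) (b : L) :
    IsChain (· ≤ ·) (Set.Icc b (z ⊔ b)) := by
  intro x hx y hy _
  have key : ∀ {x}, x ∈ Set.Icc b (z ⊔ b) → x = b ⊔ z ⊓ x := fun {x} hx => by
    rw [← sup_inf_assoc_of_le z hx.1, sup_comm b z, inf_of_le_right hx.2]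
  rcases hz.le_total (inf_le_left : z ⊓ x ≤ z) (inf_le_left : z ⊓ y ≤ z) with h | h
  · left; show x ≤ y; rw [key hx, key hy]; exact sup_le_sup_left h _
  · right; show y ≤ x; rw [key hx, key hy]; exact sup_le_sup_left h _

theorem Finset.SupIndep.update_cycle {ι : Type*} [DecidableEq ι] {t : Finset ι} {f : ι → L}
    (h : t.SupIndep f) {a : ι} {c : L} (hc : IsCycle c) (hac : f a ≤ c) (h0 : f a ≠ ⊥) :
    t.SupIndep (Function.update f a c) := by
  have hup : ∀ i ∈ t.erase a, Function.update f a c i = f i := fun i hi =>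
    Function.update_of_ne (Finset.ne_of_mem_erase hi) _ _
  have h1 : (t.erase a).SupIndep (Function.update f a c) :=
    (h.subset (Finset.erase_subset _ _)).mono fun i hi => (hup i hi).le
  by_cases ha : a ∈ t
  · rw [← Finset.insert_erase ha]
    refine h1.insert ?_
    rw [Function.update_self, Finset.sup_congr rfl hup]
    exact hc.disjoint_of_disjoint hac h0
      (h (Finset.erase_subset _ _) ha (Finset.notMem_erase _ _))
  · rwa [Finset.erase_eq_of_notMem ha] at h1

/-- Independent nonzero elements may be enlarged to cycles above them. -/
theorem Finset.SupIndep.of_le_cycles {ι : Type*} {t : Finset ι} {f g : ι → L}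
    (h : t.SupIndep f) (hg : ∀ i ∈ t, IsCycle (g i)) (hfg : ∀ i ∈ t, f i ≤ g i)
    (h0 : ∀ i ∈ t, f i ≠ ⊥) : t.SupIndep g := by
  classical
  suffices H : ∀ r ⊆ t, t.SupIndep (fun i => if i ∈ r then g i else f i) from
    (H t subset_rfl).mono fun i hi => by simp [hi]
  intro r
  induction r using Finset.induction_on with
  | empty => intro; simpa using h
  | insert a r ha ih =>
    intro hr
    have hat := hr (Finset.mem_insert_self a r)
    have := (ih ((Finset.subset_insert a r).trans hr)).update_cycle (a := a) (hg a hat)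
      (by simpa [ha] using hfg a hat) (by simpa [ha] using h0 a hat)
    refine this.mono fun i _ => ?_
    rcases eq_or_ne i a with rfl | hne
    · simp
    · simp [hne]

/-- The interval `[0, x]` is complemented. -/
def HasComplementsBelow (x : L) : Prop := ∀ y ≤ x, ∃ w, Disjoint w y ∧ w ⊔ y = x

theorem HasComplementsBelow.mono {x y : L} (hx : HasComplementsBelow x) (h : y ≤ x) :
    HasComplementsBelow y := by
  intro v hv
  obtain ⟨w, hw, hs⟩ := hx v (hv.trans h)
  refine ⟨w ⊓ y, hw.mono_left inf_le_left, ?_⟩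
  rw [sup_comm, ← sup_inf_assoc_of_le w hv, sup_comm, hs, inf_of_le_right h]

variable [Finite L]

/-- Take `w` maximal among the elements below `x` disjoint from `y`: an atom below `x` but not below
`w ⊔ y` could be added to `w`. -/
theorem hasComplementsBelow_of_le_of_atoms {x : L}
    (hx : ∀ t ≤ x, (∀ p, IsAtom p → p ≤ x → p ≤ t) → t = x) : HasComplementsBelow x := by
  intro y hy
  obtain ⟨w, ⟨hwx, hwy⟩, hmax⟩ := (Set.toFinite {w : L | w ≤ x ∧ Disjoint w y}).exists_maximal
    ⟨⊥, bot_le, disjoint_bot_left⟩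
  refine ⟨w, hwy, hx _ (sup_le hwx hy) fun p hp hpx => ?_⟩
  by_contra hnot
  have hd : Disjoint (w ⊔ y) p := (hp.not_le_iff_disjoint.mp hnot).symm
  have h2 : Disjoint (w ⊔ p) y := by
    rw [sup_comm w y] at hd
    have := (hwy.symm).disjoint_sup_right_of_disjoint_sup_left hd
    exact this.symm
  have h3 := hmax ⟨sup_le hwx hpx, h2⟩ le_sup_left
  exact hnot ((le_sup_right.trans h3).trans le_sup_left)

/-- Each cycle adds at most one to the rank. With `B` the join of the others, a complement `w` of `x
⊓ B` in `[0, x]` is disjoint from `B`, so `c ↦ c ⊔ B` embeds `[0, w]` in the chain `[B, z a ⊔ B]`; a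
complemented chain has length at most one. -/
theorem latticeRank_le_card_of_le_sup_cycles {ι : Type*} {t : Finset ι} {z : ι → L}
    (hz : ∀ i ∈ t, IsCycle (z i)) {x : L} (hx : HasComplementsBelow x) (hle : x ≤ t.sup z) :
    latticeRank x ≤ t.card := by
  classical
  induction t using Finset.induction_on generalizing x with
  | empty =>
    rw [Finset.sup_empty, le_bot_iff] at hle
    simp [hle, latticeRank_bot]
  | insert a t ha ih =>
    rw [Finset.sup_insert] at hle
    set B := t.sup z
    have hy := ih (fun i hi => hz i (Finset.mem_insert_of_mem hi))
      (hx.mono (inf_le_left : x ⊓ B ≤ x)) inf_le_right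
    obtain ⟨w, hw, hs⟩ := hx (x ⊓ B) inf_le_left
    have hwx : w ≤ x := hs ▸ le_sup_left
    have hwB : Disjoint w B := fun u h1 h2 => hw h1 (le_inf (h1.trans hwx) h2)
    have hwc := hx.mono hwx
    rw [Finset.card_insert_of_notMem ha, ← hs, latticeRank_sup_of_disjoint hw]
    suffices latticeRank w ≤ 1 by omega
    rcases eq_bot_or_exists_atom_le w with rfl | ⟨p, hp, hpw⟩
    · simp [latticeRank_bot]
    obtain ⟨v, hv, hvs⟩ := hwc p hpw
    have hvw : v ≤ w := hvs ▸ le_sup_left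
    have hchain := (hz a (Finset.mem_insert_self _ _)).isChain_Icc_sup B
    have key : ∀ {c d}, c ≤ w → d ≤ w → c ⊔ B ≤ d ⊔ B → c ≤ d := fun {c d} hc hd h => by
      calc c ≤ (d ⊔ B) ⊓ w := le_inf (le_sup_left.trans h) hc
        _ = d ⊔ B ⊓ w := sup_inf_assoc_of_le B hd
        _ = d := by rw [inf_comm, hwB.eq_bot, sup_bot_eq]
    have hmem : ∀ {c}, c ≤ w → c ⊔ B ∈ Set.Icc B (z a ⊔ B) := fun {c} hc =>
      ⟨le_sup_right, sup_le (hc.trans (hwx.trans hle)) le_sup_right⟩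
    have hv0 : v = ⊥ := by
      rcases hchain.total (hmem hpw) (hmem hvw) with h | h
      · exact absurd (le_bot_iff.mp (hv (key hpw hvw h) le_rfl)) hp.1
      · exact le_bot_iff.mp (hv le_rfl (key hvw hpw h))
    rw [hv0, bot_sup_eq] at hvs
    rw [← hvs, latticeRank_covBy hp.bot_covBy, latticeRank_bot]

end Cycles

/-! ### Partitions inside a rectangle and their complements. -/

section Partitions

theorem mem_rectPartition {s n : ℕ} {c : ℕ × ℕ} : c ∈ rectPartition s n ↔ c.1 < n ∧ c.2 < s := by
  simp [rectPartition, YoungDiagram.mem_ofRowLens]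

theorem mem_rectSub {s n : ℕ} {μ : YoungDiagram} {c : ℕ × ℕ} :
    c ∈ rectSub s n μ ↔ c.1 < n ∧ c.2 < s - μ.rowLen (n - 1 - c.1) := by
  simp [rectSub, YoungDiagram.mem_ofRowLens, Fin.val_rev, Nat.sub_sub, add_comm]

theorem YoungDiagram.le_iff_rowLen_le {μ ν : YoungDiagram} :
    μ ≤ ν ↔ ∀ i, μ.rowLen i ≤ ν.rowLen i := by
  refine ⟨fun h i => ?_, fun h c hc => ?_⟩
  · by_contra hlt
    rw [not_le, ← YoungDiagram.mem_iff_lt_rowLen] at hlt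
    exact absurd (YoungDiagram.mem_iff_lt_rowLen.mp (h hlt)) (lt_irrefl _)
  · obtain ⟨i, j⟩ := c
    have hc' : (i, j) ∈ μ := hc
    have : (i, j) ∈ ν :=
      YoungDiagram.mem_iff_lt_rowLen.mpr ((YoungDiagram.mem_iff_lt_rowLen.mp hc').trans_le (h i))
    exact this

theorem YoungDiagram.rowLen_eq_of_mem_iff {μ : YoungDiagram} {i m : ℕ}
    (h : ∀ j, (i, j) ∈ μ ↔ j < m) : μ.rowLen i = m :=
  eq_of_forall_lt_iff fun j => by rw [← YoungDiagram.mem_iff_lt_rowLen, h]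

theorem rowLen_rectPartition (s n i : ℕ) :
    (rectPartition s n).rowLen i = if i < n then s else 0 :=
  YoungDiagram.rowLen_eq_of_mem_iff fun j => by
    rw [mem_rectPartition]; split_ifs with h <;> simp [h]

theorem rowLen_rectSub (s n : ℕ) (μ : YoungDiagram) (i : ℕ) :
    (rectSub s n μ).rowLen i = if i < n then s - μ.rowLen (n - 1 - i) else 0 :=
  YoungDiagram.rowLen_eq_of_mem_iff fun j => by
    rw [mem_rectSub]; split_ifs with h <;> simp [h]

theorem YoungDiagram.rowLen_eq_zero_of_colLen_le {μ : YoungDiagram} {i : ℕ}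
    (h : μ.colLen 0 ≤ i) : μ.rowLen i = 0 := by
  by_contra hne
  have := YoungDiagram.mem_iff_lt_rowLen.mpr (Nat.pos_of_ne_zero hne)
  exact absurd (YoungDiagram.mem_iff_lt_colLen.mp this) (not_lt.mpr h)

theorem YoungDiagram.colLen_le_of_rowLen_eq_zero {μ : YoungDiagram} {n : ℕ}
    (h : ∀ i, n ≤ i → μ.rowLen i = 0) : μ.colLen 0 ≤ n := by
  by_contra hlt
  have h1 := YoungDiagram.mem_iff_lt_rowLen.mp (YoungDiagram.mem_iff_lt_colLen.mpr (not_le.mp hlt))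
  rw [h n le_rfl] at h1
  exact lt_irrefl _ h1

theorem le_rectPartition_iff {s n : ℕ} {μ : YoungDiagram} :
    μ ≤ rectPartition s n ↔ μ.colLen 0 ≤ n ∧ ∀ i < n, μ.rowLen i ≤ s := by
  rw [YoungDiagram.le_iff_rowLen_le]
  simp only [rowLen_rectPartition]
  refine ⟨fun h => ⟨YoungDiagram.colLen_le_of_rowLen_eq_zero fun i hi => ?_, fun i hi => ?_⟩,
    fun h i => ?_⟩
  · simpa [not_lt.mpr hi] using h i
  · simpa [hi] using h i
  · split_ifs with hi
    · exact h.2 i hi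
    · exact (YoungDiagram.rowLen_eq_zero_of_colLen_le (h.1.trans (not_lt.mp hi))).le

theorem rectSub_le (s n : ℕ) (μ : YoungDiagram) : rectSub s n μ ≤ rectPartition s n := by
  rw [YoungDiagram.le_iff_rowLen_le]
  intro i
  rw [rowLen_rectSub, rowLen_rectPartition]
  split_ifs <;> simp

theorem rectSub_rectSub {s n : ℕ} {μ : YoungDiagram} (h : μ ≤ rectPartition s n) :
    rectSub s n (rectSub s n μ) = μ := by
  have key : ∀ i, (rectSub s n (rectSub s n μ)).rowLen i = μ.rowLen i := fun i => by
    have h1 := YoungDiagram.le_iff_rowLen_le.mp h i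
    rw [rowLen_rectPartition] at h1
    rw [rowLen_rectSub, rowLen_rectSub]
    split_ifs at h1 ⊢ with h2 h3
    · rw [show n - 1 - (n - 1 - i) = i by omega]; omega
    · omega
    · omega
  exact le_antisymm (YoungDiagram.le_iff_rowLen_le.mpr fun i => (key i).le)
    (YoungDiagram.le_iff_rowLen_le.mpr fun i => (key i).ge)

end Partitions

/-! ### Types through cycles indexed by natural numbers. -/

section HasType

variable {L : Type*} [Lattice L] [BoundedOrder L]

theorem supIndep_range_iff {k : ℕ} {z : ℕ → L} :
    (Finset.range k).SupIndep z ↔ IsIndependent fun i : Fin k => z i := by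
  have h : (Finset.univ : Finset (Fin k)).map Fin.valEmbedding = Finset.range k := by
    ext; simp
  rw [← h, Finset.supIndep_map, Finset.supIndep_iff_disjoint_erase]
  simp only [IsIndependent, disjoint_comm, disjoint_iff, Finset.mem_univ, true_imp_iff]
  exact Iff.rfl

theorem sup_univ_fin {k : ℕ} {z : ℕ → L} :
    (Finset.univ.sup fun i : Fin k => z i) = (Finset.range k).sup z := by
  have h : (Finset.univ : Finset (Fin k)).map Fin.valEmbedding = Finset.range k := by
    ext; simp
  rw [← h, Finset.sup_map]
  rfl

variable [Finite L]

theorem HasType.exists_cycles {u : L} {μ : YoungDiagram} (h : HasType u μ) :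
    ∃ z : ℕ → L, (∀ i < μ.colLen 0, IsCycle (z i) ∧ z i ≠ ⊥) ∧
      (∀ i, latticeRank (z i) = μ.rowLen i) ∧ (Finset.range (μ.colLen 0)).SupIndep z ∧
      (Finset.range (μ.colLen 0)).sup z = u := by
  obtain ⟨z, hz, hi, hs, hh⟩ := h
  set z' : ℕ → L := fun i => if h : i < μ.colLen 0 then z ⟨i, h⟩ else ⊥
  have hz' : (fun i : Fin (μ.colLen 0) => z' i) = z := by ext i; simp [z']
  refine ⟨z', fun i hik => ?_, fun i => ?_, ?_, ?_⟩
  · simpa [z', hik] using hz ⟨i, hik⟩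
  · by_cases hik : i < μ.colLen 0
    · have := hh ⟨i, hik⟩
      rw [← coe_latticeRank] at this
      simpa [z', hik] using (by exact_mod_cast this : latticeRank (z ⟨i, hik⟩) = μ.rowLen i)
    · simp [z', hik, latticeRank_bot, YoungDiagram.rowLen_eq_zero_of_colLen_le (not_lt.mp hik)]
  · rw [supIndep_range_iff, hz']; exact hi
  · rw [← sup_univ_fin, hz', hs]

/-- Here `n` may exceed the number of parts; the surplus cycles have rank zero and drop out of the
join. -/
theorem HasType.of_cycles {u : L} {μ : YoungDiagram} {n : ℕ} {z : ℕ → L}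
    (hn : μ.colLen 0 ≤ n) (hz : ∀ i < n, IsCycle (z i))
    (hr : ∀ i < n, latticeRank (z i) = μ.rowLen i) (hi : (Finset.range n).SupIndep z)
    (hs : (Finset.range n).sup z = u) : HasType u μ := by
  have hsub : Finset.range (μ.colLen 0) ⊆ Finset.range n := Finset.range_subset_range.mpr hn
  refine ⟨fun i => z i, fun i => ⟨hz i (i.2.trans_le hn), fun h0 => ?_⟩,
    supIndep_range_iff.mp (hi.subset hsub), ?_, fun i => ?_⟩
  · have h1 := hr i (i.2.trans_le hn)
    rw [show z i = ⊥ from h0, latticeRank_bot] at h1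
    have h2 := YoungDiagram.mem_iff_lt_rowLen.mp (YoungDiagram.mem_iff_lt_colLen.mpr i.2)
    omega
  · rw [sup_univ_fin, ← hs]
    refine le_antisymm (Finset.sup_mono hsub) (Finset.sup_le fun i hin => ?_)
    by_cases hik : i < μ.colLen 0
    · exact Finset.le_sup (f := z) (Finset.mem_range.mpr hik)
    · have h1 := hr i (Finset.mem_range.mp hin)
      rw [YoungDiagram.rowLen_eq_zero_of_colLen_le (not_lt.mp hik), latticeRank_eq_zero] at h1
      rw [h1]; exact bot_le
  · rw [← coe_latticeRank, hr i (i.2.trans_le hn)]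

end HasType

/-! ### Frames, and the effect of a duality on types. -/

section Frames

variable {L : Type*} [Lattice L] [BoundedOrder L] [Finite L]

/-- `1` is the join of the `n` independent cycles `y 0, …, y (n - 1)` of height `s`. -/
structure IsFrame (s n : ℕ) (y : ℕ → L) : Prop where
  cycle : ∀ i < n, IsCycle (y i)
  rank : ∀ i < n, latticeRank (y i) = s
  indep : (Finset.range n).SupIndep y
  sup_eq : (Finset.range n).sup y = ⊤

theorem isFrame_of_hasType_top {s n : ℕ} (hs : 0 < s)
    (h : HasType (⊤ : L) (rectPartition s n)) : ∃ y : ℕ → L, IsFrame s n y := by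
  obtain ⟨z, hz, hr, hi, hsup⟩ := h.exists_cycles
  have hc : (rectPartition s n).colLen 0 = n := eq_of_forall_lt_iff fun i => by
    rw [← YoungDiagram.mem_iff_lt_colLen, mem_rectPartition]; simp [hs]
  rw [hc] at hz hi hsup
  exact ⟨z, fun i hi => (hz i hi).1, fun i hi => by simp [hr, rowLen_rectPartition, hi], hi, hsup⟩

theorem IsFrame.exists_hasType {s n : ℕ} {y : ℕ → L} (hy : IsFrame s n y) {μ : YoungDiagram}
    (hμ : μ ≤ rectPartition s n) : ∃ u : L, HasType u μ := by
  obtain ⟨hn, hμs⟩ := le_rectPartition_iff.mp hμ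
  have hex : ∀ i, ∃ w, i < n → w ≤ y i ∧ latticeRank w = μ.rowLen i := fun i => by
    by_cases h : i < n
    · obtain ⟨w, hw⟩ := exists_le_latticeRank_eq ((hμs i h).trans_eq (hy.rank i h).symm)
      exact ⟨w, fun _ => hw⟩
    · exact ⟨⊥, fun h' => absurd h' h⟩
  choose w hw using hex
  exact ⟨_, HasType.of_cycles hn (fun i h => (hy.cycle i h).mono (hw i h).1)
    (fun i h => (hw i h).2) (hy.indep.mono fun i h => (hw i (Finset.mem_range.mp h)).1) rfl⟩

variable [IsModularLattice L]

theorem latticeRank_sup_range {s m : ℕ} {y : ℕ → L} (hr : ∀ i < m, latticeRank (y i) = s)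
    (hi : (Finset.range m).SupIndep y) : latticeRank ((Finset.range m).sup y) = m * s := by
  rw [latticeRank_finset_sup hi, Finset.sum_congr rfl fun i h => hr i (Finset.mem_range.mp h)]
  simp

theorem IsFrame.latticeRank_top {s n : ℕ} {y : ℕ → L} (hy : IsFrame s n y) :
    latticeRank (⊤ : L) = n * s := by
  rw [← hy.sup_eq, latticeRank_sup_range hy.rank hy.indep]

/-- A join of fewer than `n` cycles does not contain all atoms. -/
theorem IsFrame.exists_atom_not_le {s n : ℕ} (hs : 0 < s) {y : ℕ → L} (hy : IsFrame s n y)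
    {m : ℕ} (hmn : m < n) {z : ℕ → L} (hz : ∀ i < m, IsCycle (z i)) :
    ∃ p, IsAtom p ∧ ¬ p ≤ (Finset.range m).sup z := by
  by_contra hall
  push Not at hall
  have hex : ∀ i, ∃ p, i < n → IsAtom p ∧ p ≤ y i := fun i => by
    by_cases hin : i < n
    · obtain h | ⟨p, hp, hpy⟩ := eq_bot_or_exists_atom_le (y i)
      · have h1 := hy.rank i hin
        rw [h, latticeRank_bot] at h1
        omega
      · exact ⟨p, fun _ => ⟨hp, hpy⟩⟩
    · exact ⟨⊥, fun h => absurd h hin⟩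
  choose a ha using hex
  have hai : (Finset.range n).SupIndep a :=
    hy.indep.mono fun i hi => (ha i (Finset.mem_range.mp hi)).2
  have har : ∀ i < n, latticeRank (a i) = 1 := fun i hi => by
    rw [latticeRank_covBy (ha i hi).1.bot_covBy, latticeRank_bot]
  have h1 := latticeRank_sup_range har hai
  -- The join of one atom below each frame member is complemented of rank `n`, too large to lie
  -- below `m < n` cycles.
  have h2 : HasComplementsBelow ((Finset.range n).sup a) :=
    hasComplementsBelow_of_le_of_atoms fun t ht hat => le_antisymm ht
      (Finset.sup_le fun i hi => hat _ (ha i (Finset.mem_range.mp hi)).1 (Finset.le_sup hi))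
  have h3 := latticeRank_le_card_of_le_sup_cycles
    (t := Finset.range m) (z := z) (fun i hi => hz i (Finset.mem_range.mp hi)) h2
    (Finset.sup_le fun i hi => hall _ (ha i (Finset.mem_range.mp hi)).1)
  rw [Finset.card_range] at h3
  omega

/-- A family of `n` such cycles has join of full rank `n * s`. A shorter one misses an atom, and a
cycle of height `s` above it stays independent of the family. -/
theorem IsFrame.extend {s n : ℕ} (hs : 0 < s) {y : ℕ → L} (hy : IsFrame s n y)
    (hcycle : ∀ z : L, IsCycle z → ∃ z' : L, IsCycle z' ∧ z ≤ z' ∧ latticeRank z' = s)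
    {m : ℕ} {z : ℕ → L} (hz : ∀ i < m, IsCycle (z i)) (hr : ∀ i < m, latticeRank (z i) = s)
    (hi : (Finset.range m).SupIndep z) :
    m ≤ n ∧ ∃ y' : ℕ → L, IsFrame s n y' ∧ ∀ i < m, y' i = z i := by
  have hmn : m ≤ n := by
    have h1 := latticeRank_mono (le_top : (Finset.range m).sup z ≤ ⊤)
    rw [latticeRank_sup_range hr hi, hy.latticeRank_top] at h1
    exact Nat.le_of_mul_le_mul_right h1 hs
  refine ⟨hmn, ?_⟩
  obtain ⟨d, rfl⟩ := Nat.exists_eq_add_of_le hmn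
  clear hmn
  induction d generalizing m z with
  | zero =>
    refine ⟨z, ⟨hz, hr, hi, eq_of_le_of_latticeRank_le le_top ?_⟩, fun _ _ => rfl⟩
    rw [hy.latticeRank_top, Nat.add_zero, latticeRank_sup_range hr hi]
  | succ d ih =>
    obtain ⟨p, hp, hpz⟩ := hy.exists_atom_not_le hs (by omega : m < m + (d + 1)) hz
    have hpc : IsCycle p := by
      intro a ha b hb _
      rcases hp.le_iff.mp ha.2 with rfl | rfl
      · exact Or.inl bot_le
      · exact Or.inr hb.2
    obtain ⟨q, hq, hpq, hqs⟩ := hcycle p hpc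
    have hlt : ∀ i < m, Function.update z m q i = z i := fun i hi =>
      Function.update_of_ne hi.ne _ _
    have hind : (Finset.range (m + 1)).SupIndep (Function.update z m q) := by
      rw [Finset.range_add_one]
      have hle : ∀ i ∈ Finset.range m, Function.update z m q i = z i := fun i hi =>
        hlt i (Finset.mem_range.mp hi)
      refine (hi.mono fun i hi => (hle i hi).le).insert ?_
      rw [Function.update_self, Finset.sup_congr rfl hle]
      exact hq.disjoint_of_disjoint hpq hp.1 (hp.not_le_iff_disjoint.mp hpz)
    obtain ⟨y', hy', he⟩ := ih (m := m + 1) (z := Function.update z m q)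
      (fun i hi => by
        rcases Nat.lt_succ_iff_lt_or_eq.mp hi with h | rfl
        · rw [hlt i h]; exact hz i h
        · rwa [Function.update_self])
      (fun i hi => by
        rcases Nat.lt_succ_iff_lt_or_eq.mp hi with h | rfl
        · rw [hlt i h]; exact hr i h
        · rwa [Function.update_self])
      hind (by rwa [show m + 1 + d = m + (d + 1) by omega])
    rw [show m + 1 + d = m + (d + 1) by omega] at hy'
    exact ⟨y', hy', fun i hi => (he i (by omega)).trans (hlt i hi)⟩

/-- Every element is the join of cycles below the members of a suitable frame. -/
theorem HasType.exists_frame {s n : ℕ} (hs : 0 < s) {y : ℕ → L} (hy : IsFrame s n y)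
    (hcycle : ∀ z : L, IsCycle z → ∃ z' : L, IsCycle z' ∧ z ≤ z' ∧ latticeRank z' = s)
    {u : L} {μ : YoungDiagram} (hu : HasType u μ) :
    μ.colLen 0 ≤ n ∧ ∃ y' w : ℕ → L, IsFrame s n y' ∧ (∀ i < n, w i ≤ y' i) ∧
      (∀ i < n, latticeRank (w i) = μ.rowLen i) ∧ (Finset.range n).sup w = u := by
  obtain ⟨z, hz, hr, hi, hsup⟩ := hu.exists_cycles
  have hex : ∀ i, ∃ z', i < μ.colLen 0 → IsCycle z' ∧ z i ≤ z' ∧ latticeRank z' = s := fun i => by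
    by_cases h : i < μ.colLen 0
    · obtain ⟨z', h'⟩ := hcycle (z i) (hz i h).1
      exact ⟨z', fun _ => h'⟩
    · exact ⟨⊥, fun h' => absurd h' h⟩
  choose g hg using hex
  have hgi : (Finset.range (μ.colLen 0)).SupIndep g :=
    hi.of_le_cycles (fun i h => (hg i (Finset.mem_range.mp h)).1)
      (fun i h => (hg i (Finset.mem_range.mp h)).2.1) fun i h => (hz i (Finset.mem_range.mp h)).2
  obtain ⟨hn, y', hy', he⟩ := hy.extend hs hcycle (fun i h => (hg i h).1)
    (fun i h => (hg i h).2.2) hgi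
  have hz0 : ∀ i, ¬ i < μ.colLen 0 → z i = ⊥ := fun i h => by
    rw [← latticeRank_eq_zero, hr, YoungDiagram.rowLen_eq_zero_of_colLen_le (not_lt.mp h)]
  refine ⟨hn, y', z, hy', fun i _ => ?_, fun i _ => hr i, ?_⟩
  · by_cases h : i < μ.colLen 0
    · rw [he i h]; exact (hg i h).2.1
    · rw [hz0 i h]; exact bot_le
  · rw [← hsup]
    refine le_antisymm (Finset.sup_le fun i _ => ?_)
      (Finset.sup_mono (Finset.range_subset_range.mpr hn))
    by_cases h : i < μ.colLen 0
    · exact Finset.le_sup (f := z) (Finset.mem_range.mpr h)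
    · rw [hz0 i h]; exact bot_le

theorem HasType.le_rectPartition {s n : ℕ} (hs : 0 < s) {y : ℕ → L} (hy : IsFrame s n y)
    (hcycle : ∀ z : L, IsCycle z → ∃ z' : L, IsCycle z' ∧ z ≤ z' ∧ latticeRank z' = s)
    {u : L} {μ : YoungDiagram} (hu : HasType u μ) : μ ≤ rectPartition s n := by
  obtain ⟨hn, y', w, hy', hw, hr, -⟩ := hu.exists_frame hs hy hcycle
  refine le_rectPartition_iff.mpr ⟨hn, fun i hi => ?_⟩
  rw [← hr i hi, ← hy'.rank i hi]
  exact latticeRank_mono (hw i hi)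

/-- The meets of the complementary joins of a frame form a frame of the dual lattice. -/
theorem IsFrame.dual {s n : ℕ} {y : ℕ → L} (hy : IsFrame s n y) (σ : L ≃o Lᵒᵈ) :
    IsFrame s n fun i => OrderDual.ofDual (σ (((Finset.range n).erase i).sup y)) := by
  set D : ℕ → L := fun i => ((Finset.range n).erase i).sup y with hD
  have hsup : ∀ i < n, y i ⊔ D i = ⊤ := fun i hi => by
    rw [hD, ← hy.sup_eq, ← Finset.sup_insert, Finset.insert_erase (Finset.mem_range.mpr hi)]
  have hdisj : ∀ i < n, Disjoint (y i) (D i) := fun i hi =>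
    hy.indep (Finset.erase_subset _ _) (Finset.mem_range.mpr hi) (Finset.notMem_erase _ _)
  have hrank : ∀ i < n, latticeRank (OrderDual.ofDual (σ (D i))) = s := fun i hi => by
    have h1 := latticeRank_sup_of_disjoint (hdisj i hi)
    rw [hsup i hi, hy.rank i hi] at h1
    have h2 := latticeRank_add_latticeRank_dual σ (D i)
    omega
  have hind : (Finset.range n).SupIndep fun i => OrderDual.ofDual (σ (D i)) := by
    rw [Finset.supIndep_iff_disjoint_erase]
    intro i hi
    -- The other members all lie below `σ (y i)`, which is disjoint from `σ (D i)` because `y i ⊔ D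
    -- i = ⊤`.
    have h1 : ((Finset.range n).erase i).sup (fun j => OrderDual.ofDual (σ (D j))) ≤
        OrderDual.ofDual (σ (y i)) := Finset.sup_le fun j hj => by
      have : y i ≤ D j := Finset.le_sup (f := y)
        (Finset.mem_erase.mpr ⟨(Finset.ne_of_mem_erase hj).symm, hi⟩)
      exact σ.monotone this
    refine Disjoint.mono_right h1 (disjoint_iff.mpr ?_)
    have h2 : σ (y i ⊔ D i) = σ ⊤ := by rw [hsup i (Finset.mem_range.mp hi)]
    rw [map_sup, map_top, sup_comm] at h2
    exact h2
  refine ⟨fun i hi => ?_, hrank, hind, eq_of_le_of_latticeRank_le le_top ?_⟩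
  · have hch := (hy.cycle i hi).isChain_Icc_sup (D i)
    rw [hsup i hi] at hch
    intro a ha b hb _
    have key : ∀ {a}, a ≤ OrderDual.ofDual (σ (D i)) →
        σ.symm (OrderDual.toDual a) ∈ Set.Icc (D i) ⊤ := fun {a} ha =>
      ⟨σ.le_symm_apply.mpr ha, le_top⟩
    rcases hch.total (key ha.2) (key hb.2) with h | h
    · right; exact σ.symm.le_iff_le.mp h
    · left; exact σ.symm.le_iff_le.mp h
  · rw [latticeRank_sup_range hrank hind, hy.latticeRank_top]

/-- The image of an element of type `μ` under a duality has type `(s^n) - μ`. -/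
theorem HasType.dual {s n : ℕ} (hs : 0 < s) {y : ℕ → L} (hy : IsFrame s n y)
    (hcycle : ∀ z : L, IsCycle z → ∃ z' : L, IsCycle z' ∧ z ≤ z' ∧ latticeRank z' = s)
    (σ : L ≃o Lᵒᵈ) {u : L} {μ : YoungDiagram} (hu : HasType u μ) :
    HasType (OrderDual.ofDual (σ u)) (rectSub s n μ) := by
  obtain ⟨hn, y', w, hy', hw, hr, hsup⟩ := hu.exists_frame hs hy hcycle
  have hF := hy'.dual σ
  set D : ℕ → L := fun i => ((Finset.range n).erase i).sup y' with hD
  set v : ℕ → L := fun i => OrderDual.ofDual (σ (w i ⊔ D i)) with hv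
  have hle : ∀ i < n, v i ≤ OrderDual.ofDual (σ (D i)) := fun i _ =>
    σ.monotone (le_sup_right : D i ≤ w i ⊔ D i)
  have hind : (Finset.range n).SupIndep v :=
    hF.indep.mono fun i hi => hle i (Finset.mem_range.mp hi)
  have hrank : ∀ i < n, latticeRank (v i) + μ.rowLen i = s := fun i hi => by
    have hd : Disjoint (w i) (D i) := Disjoint.mono_left (hw i hi)
      (hy'.indep (Finset.erase_subset _ _) (Finset.mem_range.mpr hi) (Finset.notMem_erase _ _))
    have h1 := latticeRank_sup_of_disjoint hd
    have h2 := latticeRank_add_latticeRank_dual σ (w i ⊔ D i)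
    have h3 := latticeRank_add_latticeRank_dual σ (D i)
    have h4 : latticeRank (OrderDual.ofDual (σ (D i))) = s := hF.rank i hi
    have h5 := hr i hi
    simp only [hv]
    omega
  -- Only one inequality is direct; both sides have rank `n * s - ∑ μ_i`, which gives equality.
  have hvu : (Finset.range n).sup v = OrderDual.ofDual (σ u) := by
    refine eq_of_le_of_latticeRank_le (Finset.sup_le fun i hi => ?_) ?_
    · refine σ.monotone (?_ : u ≤ w i ⊔ D i)
      rw [← hsup]
      refine Finset.sup_le fun j hj => ?_
      rcases eq_or_ne j i with rfl | hne
      · exact le_sup_left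
      · exact ((hw j (Finset.mem_range.mp hj)).trans
          (Finset.le_sup (f := y') (Finset.mem_erase.mpr ⟨hne, hj⟩))).trans le_sup_right
    · have h1 := latticeRank_add_latticeRank_dual σ u
      have h2 : latticeRank u = ∑ i ∈ Finset.range n, μ.rowLen i := by
        rw [← hsup, latticeRank_finset_sup
          (hy'.indep.mono fun i hi => hw i (Finset.mem_range.mp hi))]
        exact Finset.sum_congr rfl fun i hi => hr i (Finset.mem_range.mp hi)
      have h3 : ∑ i ∈ Finset.range n, latticeRank (v i) + ∑ i ∈ Finset.range n, μ.rowLen i =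
          n * s := by
        rw [← Finset.sum_add_distrib,
          Finset.sum_congr rfl fun i hi => hrank i (Finset.mem_range.mp hi)]
        simp
      rw [latticeRank_finset_sup hind]
      have h4 := hy'.latticeRank_top
      omega
  -- The heights `s - μ_i` increase with `i`, so the cycles are re-indexed by `i ↦ n - 1 - i`.
  have himg : (Finset.range n).image (fun i => n - 1 - i) = Finset.range n := by
    ext j
    simp only [Finset.mem_image, Finset.mem_range]
    exact ⟨fun ⟨i, hi, h⟩ => by omega, fun hj => ⟨n - 1 - j, by omega, by omega⟩⟩
  have hinj : Set.InjOn (fun i => n - 1 - i) (Finset.range n : Set ℕ) := fun i hi j hj h => by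
    have hi' := Finset.mem_range.mp hi
    have hj' := Finset.mem_range.mp hj
    simp only at h
    omega
  refine HasType.of_cycles (n := n) (z := fun i => v (n - 1 - i))
    (le_rectPartition_iff.mp (rectSub_le s n μ)).1 (fun i hi => ?_) (fun i hi => ?_) ?_ ?_
  · exact (hF.cycle _ (by omega)).mono (hle (n - 1 - i) (by omega))
  · rw [rowLen_rectSub, if_pos hi]
    have := hrank (n - 1 - i) (by omega)
    omega
  · rw [Finset.supIndep_iff_disjoint_erase]
    intro i hi
    have hi' := Finset.mem_range.mp hi
    have hj : n - 1 - i ∈ Finset.range n := Finset.mem_range.mpr (by omega)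
    refine (hind (Finset.erase_subset _ _) hj (Finset.notMem_erase (n - 1 - i) _)).mono_right
      (Finset.sup_le fun k hk => ?_)
    have hk' := Finset.mem_range.mp (Finset.mem_of_mem_erase hk)
    have hne := Finset.ne_of_mem_erase hk
    exact Finset.le_sup (f := v)
      (Finset.mem_erase.mpr ⟨by omega, Finset.mem_range.mpr (by omega)⟩)
  · rw [← hvu]
    conv_rhs => rw [← himg, Finset.sup_image]
    rfl

/-- A duality exchanges the elements above `u` with the elements below its image. -/
theorem upCount_eq_downCount_dual {s n : ℕ} (hs : 0 < s) {y : ℕ → L} (hy : IsFrame s n y)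
    (hcycle : ∀ z : L, IsCycle z → ∃ z' : L, IsCycle z' ∧ z ≤ z' ∧ latticeRank z' = s)
    (σ : L ≃o Lᵒᵈ) (u : L) {φ : YoungDiagram} (hφ : φ ≤ rectPartition s n) :
    upCount u φ = downCount (OrderDual.ofDual (σ u)) (rectSub s n φ) := by
  rw [upCount, downCount, ← Set.ncard_image_of_injective (f := fun x => OrderDual.ofDual (σ x)) _
    (OrderDual.ofDual.injective.comp σ.injective)]
  congr 1
  ext x
  simp only [Set.mem_image, Set.mem_ofPred_eq]
  constructor
  · rintro ⟨w, ⟨hw, huw⟩, rfl⟩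
    exact ⟨hw.dual hs hy hcycle σ, σ.monotone huw⟩
  · rintro ⟨hx, hxu⟩
    refine ⟨σ.symm (OrderDual.toDual x), ⟨?_, σ.le_symm_apply.mpr hxu⟩, by simp⟩
    -- The inverse duality complements the type once more, returning `φ`.
    have h := hx.dual hs hy hcycle ((OrderIso.dualDual L).trans σ.symm.dual)
    rw [rectSub_rectSub hφ] at h
    exact h

end Frames

theorem mainTheorem1 {L : Type*} [Lattice L] [BoundedOrder L]
    (hdown : IsDownEnumerable L) (hdual : Nonempty (L ≃o Lᵒᵈ))
    (s n : ℕ) (hs : 0 < s) (hn : 0 < n)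
    (htype : HasType (⊤ : L) (rectPartition s n))
    (hcycle : ∀ z : L, IsCycle z → ∃ z' : L, IsCycle z' ∧ z ≤ z' ∧ Order.height z' = s) :
    IsEnumerable L ∧
      ∀ μ φ : YoungDiagram, μ ≤ rectPartition s n → φ ≤ rectPartition s n →
        (∃ u : L, HasType u μ) ∧ (∃ u : L, HasType u (rectSub s n μ)) ∧
          enumBeta L μ φ = enumAlpha L (rectSub s n μ) (rectSub s n φ) := by
  have := hdown.finite
  have := hdown.semiPrimary.modular
  obtain ⟨σ⟩ := hdual
  obtain ⟨y, hy⟩ := isFrame_of_hasType_top hs htype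
  have hcyc : ∀ z : L, IsCycle z → ∃ z' : L, IsCycle z' ∧ z ≤ z' ∧ latticeRank z' = s :=
    fun z hz => by
      obtain ⟨z', h1, h2, h3⟩ := hcycle z hz
      rw [← coe_latticeRank] at h3
      exact ⟨z', h1, h2, by exact_mod_cast h3⟩
  refine ⟨⟨hdown, hdown.finite, hdown.semiPrimary, fun u v φ hu hv μ => ?_⟩,
    fun μ φ hμ hφ => ?_⟩
  · by_cases hμ : μ ≤ rectPartition s n
    · rw [upCount_eq_downCount_dual hs hy hcyc σ u hμ, upCount_eq_downCount_dual hs hy hcyc σ v hμ]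
      exact hdown.downCount_eq _ _ _ (hu.dual hs hy hcyc σ) (hv.dual hs hy hcyc σ) _
    -- No element has a type outside the rectangle, so both counts are zero.
    · have h0 : ∀ w : L, ¬ HasType w μ := fun w hw => hμ (hw.le_rectPartition hs hy hcyc)
      simp [upCount, h0]
  · have h1 : ∃ u : L, HasType u μ := hy.exists_hasType hμ
    have h2 : ∃ u : L, HasType u (rectSub s n μ) := hy.exists_hasType (rectSub_le s n μ)
    refine ⟨h1, h2, ?_⟩
    rw [enumBeta, enumAlpha, dif_pos h1, dif_pos h2, upCount_eq_downCount_dual hs hy hcyc σ _ hφ]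
    exact hdown.downCount_eq _ _ _ (h1.choose_spec.dual hs hy hcyc σ) h2.choose_spec _
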